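/- Let $\sigma\in C^2(\mathbb R^n;\mathbb R^{n\times m})$ have columns $\sigma_1,\dots,\sigma_m$, and consider the symmetric control system $\dot x_t=f(x_t,a_t)$, $f(x,a)=\sigma(x)a$, with controls $a_\cdot:[0,+\infty)\to B_1(0)=\{a\in\mathbb R^m:|a|\le1\}$ taken from any fixed class $\mathcal U$ of measurable controls that contains all the piecewise constant ones (for instance the piecewise constant controls, or all measurable controls). Trajectories are Caratheodory solutions. Let $u\in C^3(\mathbb R^n)$ and $\bar x\in\mathbb R^n$ satisfy $\nabla u(\bar x)\neq0$ and $\nabla u(\bar x)\,\sigma(\bar x)=0$, and let $\mathcal T\subset\mathbb R^n$ be a target which coincides with $\{x:u(x)\le u(\bar x)\}$ in a neighborhood of $\bar x$. Let $d(x)$ be the distance of $x$ from $\mathcal T$ and let $$T(x)=\inf_{a_\cdot\in\mathcal U}\ \inf\{t\ge0:\ x_t\in\mathcal T,\ x_\cdot\text{ the trajectory with control }a_\cdot,\ x_0=x\}\in[0,+\infty]$$ be the minimum time function. Put $S(x)=D(\nabla u\,\sigma)\,\sigma(x)\in\mathbb R^{m\times m}$, that is $S_{ij}=\nabla(\nabla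 u\cdot\sigma_i)\cdot\sigma_j$, let $S^*=\frac12(S+{}^tS)$, and $$K(x)=\begin{pmatrix}S^*(x)&{}^tS(x)\\ S(x)&S^*(x)\end{pmatrix}\in\mathbb R^{2m\times2m}.$$ Then $K(\bar x)$ is symmetric, and the following three conditions are equivalent: (a) there are $C,r>0$ such that $T(x)\le C|x-\bar x|^{1/2}$ for all $x$ with $|x-\bar x|\le r$; (b) $K(\bar x)$ has a negative eigenvalue; (c) writing $g_i=f(\cdot,a_i)$, $g=g_1+g_2$ and $[g_1,g_2]=Dg_2\,g_1-Dg_1\,g_2$, $$\max_{a_1,a_2\in B_1(0)}\Big\{-\mathrm{Tr}\big(D^2u(\bar x)\,g(\bar x)\otimes g(\bar x)\big)-\big(Dg\,g(\bar x)+[g_1,g_2](\bar x)\big)\cdot\nabla u(\bar x)\Big\}>0 .$$ Moreover, if these conditions hold, then there are $C,r>0$ such that $T(x)\le C\,d(x)^{1/2}$ for all $x$ with $|x-\bar x|\le r$. -/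

import Mathlib

open Set Filter Topology MeasureTheory

noncomputable section

namespace SymControl

/-- Euclidean space `ℝⁿ`. -/
abbrev E (n : ℕ) : Type := EuclideanSpace ℝ (Fin n)

/-! ### Controls, trajectories, minimum time -/

/-- `a` restricted to `[0,+∞)` is piecewise constant: on every `[0,τ]` there are finitely many
switching times, and `a` does not change on subintervals that avoid them. -/
def IsPiecewiseConstant {m : ℕ} (a : ℝ → E m) : Prop :=
  ∀ τ : ℝ, ∃ F : Finset ℝ, ∀ s t : ℝ, 0 ≤ s → s ≤ t → t ≤ τ →
    (∀ r ∈ F, r ∉ Icc s t) → a s = a t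

/-- The control `a` takes values in the closed unit ball of `ℝᵐ` at all times `t ≥ 0`. -/
def InUnitBall {m : ℕ} (a : ℝ → E m) : Prop :=
  ∀ t : ℝ, 0 ≤ t → a t ∈ Metric.closedBall (0 : E m) 1

/-- A class of admissible controls `[0,+∞) → B₁(0)`: all its members are Lebesgue measurable with
values in the closed unit ball, and it contains all the piecewise constant ones. The piecewise
constant controls, the piecewise continuous controls and the measurable (`L^∞`) controls are
such classes. Values at negative times play no role. -/
structure IsControlClass {m : ℕ} (𝒰 : Set (ℝ → E m)) : Prop where
  inUnitBall : ∀ a ∈ 𝒰, InUnitBall a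
  measurable : ∀ a ∈ 𝒰, AEStronglyMeasurable a (volume.restrict (Ici (0 : ℝ)))
  piecewiseConstant_mem : ∀ a, IsPiecewiseConstant a → InUnitBall a → a ∈ 𝒰

/-- `x` is, on `[0,t]`, a (Caratheodory) trajectory of `ẋ = f(x,a)` with `x(0) = x₀`. -/
def IsTrajectory {n m : ℕ} (f : E n → E m → E n) (a : ℝ → E m) (x₀ : E n) (t : ℝ)
    (x : ℝ → E n) : Prop :=
  ContinuousOn x (Icc 0 t) ∧ ∀ s ∈ Icc (0 : ℝ) t, x s = x₀ + ∫ r in (0 : ℝ)..s, f (x r) (a r)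

open scoped ENNReal in
/-- `t_{x₀}(a)`: the first time at which the trajectory with control `a` that starts at `x₀`
reaches the target (`+∞` if it does not). -/
def hittingTime {n m : ℕ} (f : E n → E m → E n) (target : Set (E n)) (x₀ : E n)
    (a : ℝ → E m) : ℝ≥0∞ :=
  sInf {θ : ℝ≥0∞ | ∃ t : ℝ, 0 ≤ t ∧ θ = ENNReal.ofReal t ∧
    ∃ x : ℝ → E n, IsTrajectory f a x₀ t x ∧ x t ∈ target}

open scoped ENNReal in
/-- The minimum time function `T(x₀) = inf_a t_{x₀}(a)`. -/
def minTime {n m : ℕ} (f : E n → E m → E n) (𝒰 : Set (ℝ → E m)) (target : Set (E n))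
    (x₀ : E n) : ℝ≥0∞ :=
  ⨅ a ∈ 𝒰, hittingTime f target x₀ a

/-! ### Symmetric systems, the matrices `S` and `K` -/

/-- The controlled vector field `f(x,a) = σ(x) a` of the symmetric system. -/
def symField {n m : ℕ} (σ : E n → Matrix (Fin n) (Fin m) ℝ) (x : E n) (a : E m) : E n :=
  WithLp.toLp 2 ((σ x).mulVec a.ofLp)

/-- The vector field `σⱼ` given by the `j`-th column of `σ`. -/
def column {n m : ℕ} (σ : E n → Matrix (Fin n) (Fin m) ℝ) (j : Fin m) (x : E n) : E n :=
  WithLp.toLp 2 ((σ x).col j)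

/-- The row vector `∇u σ (x)`, with entries `∇u(x) · σᵢ(x)`. -/
def gradMul {n m : ℕ} (u : E n → ℝ) (σ : E n → Matrix (Fin n) (Fin m) ℝ) (x : E n) : Fin m → ℝ :=
  fun i => fderiv ℝ u x (column σ i x)

/-- `S(x) = D(∇u σ) σ (x)`, whose `(i,j)` entry is the derivative at `x` of `∇u · σᵢ` in the
direction `σⱼ(x)`. -/
def matS {n m : ℕ} (u : E n → ℝ) (σ : E n → Matrix (Fin n) (Fin m) ℝ) (x : E n) :
    Matrix (Fin m) (Fin m) ℝ :=
  Matrix.of fun i j => fderiv ℝ (fun y => gradMul u σ y i) x (column σ j x)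

/-- The symmetric part `S*(x)` of `S(x)`. -/
def matSsym {n m : ℕ} (u : E n → ℝ) (σ : E n → Matrix (Fin n) (Fin m) ℝ) (x : E n) :
    Matrix (Fin m) (Fin m) ℝ :=
  (1 / 2 : ℝ) • (matS u σ x + (matS u σ x).transpose)

/-- The `2m × 2m` matrix `K(x)` with blocks `S*, ᵗS` in the first row and `S, S*` in the second. -/
def matK {n m : ℕ} (u : E n → ℝ) (σ : E n → Matrix (Fin n) (Fin m) ℝ) (x : E n) :
    Matrix (Fin m ⊕ Fin m) (Fin m ⊕ Fin m) ℝ :=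
  Matrix.fromBlocks (matSsym u σ x) (matS u σ x).transpose (matS u σ x) (matSsym u σ x)

/-- The real matrix `M` has a negative eigenvalue. -/
def HasNegEigenvalue {ι : Type} [Fintype ι] [DecidableEq ι] (M : Matrix ι ι ℝ) : Prop :=
  ∃ μ : ℝ, μ < 0 ∧ Module.End.HasEigenvalue (Matrix.toLin' M) μ

/-! ### The second order inequality -/

/-- With `g₁ = f(·,a₁)`, `g₂ = f(·,a₂)` and `g = g₁ + g₂`, the number
`- Tr(D²u g ⊗ g)(x) - (Dg g + [g₁,g₂])(x) · ∇u(x)`, where `[g₁,g₂] = Dg₂ g₁ - Dg₁ g₂`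
and `Tr(D²u w ⊗ w) = D²u(w,w)`. -/
def secondOrderTerm {n m : ℕ} (f : E n → E m → E n) (u : E n → ℝ) (x : E n) (a₁ a₂ : E m) : ℝ :=
  - fderiv ℝ (fderiv ℝ u) x (f x a₁ + f x a₂) (f x a₁ + f x a₂)
    - fderiv ℝ u x (fderiv ℝ (fun y => f y a₁ + f y a₂) x (f x a₁ + f x a₂)
        + VectorField.lieBracket ℝ (fun y => f y a₁) (fun y => f y a₂) x)

/-- The maximum of the second order term over `(a₁,a₂) ∈ B₁(0) × B₁(0)` exists and is positive. -/
def SecondOrderCondition {n m : ℕ} (f : E n → E m → E n) (u : E n → ℝ) (x : E n) : Prop :=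
  ∃ M : ℝ, IsGreatest ((fun p : E m × E m => secondOrderTerm f u x p.1 p.2) ''
    (Metric.closedBall 0 1 ×ˢ Metric.closedBall 0 1)) M ∧ 0 < M

end SymControl

end

noncomputable section

namespace SymControl

/-! ### Trajectories -/

section Trajectory

variable {n m : ℕ} {f : E n → E m → E n} {a : ℝ → E m} {x₀ : E n} {t : ℝ} {x : ℝ → E n}

/-! Everything reduces to the sign of `quadK`, the quadratic form of K: `hasNegEigenvalue_matK_iff`
is the spectral theorem, and `secondOrderTerm_eq` shows that the expression maximised in (c) is
exactly `-quadK`.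

If `quadK` is negative at (a,b), playing a and then b for time t each changes u by t ∇uσ(x)(a+b) +
t² (½ `quadK` + small) (`exists_isTrajectory_two_controls`). Replacing (a,b) by (-a,-b) flips the
first order term and keeps the second, so one of the two pairs lowers u by at least a multiple of
t². Since u exceeds its target level by at most a multiple of the distance d, a time of order √d
suffices.

If `quadK` is nonnegative, then S(c) is symmetric (`formS_symm_of_quadK_nonneg`) and positive
semidefinite. Symmetry makes the second order part of u along any measurable control depend only on
w = ∫a: it is ½ S(c)w·w ≥ 0, up to a small error (`IsTrajectory.abs_sub_le`). Start at c + s²v with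
∇u(c)·v = 1: there u is above its target level by about s², while ∇uσ = O(s²), so in a time of order
s the function u cannot fall far enough, and the bound in (a) fails. -/

lemma IsTrajectory.mono {s : ℝ} (hx : IsTrajectory f a x₀ t x) (hst : s ≤ t) :
    IsTrajectory f a x₀ s x :=
  ⟨hx.1.mono (Icc_subset_Icc_right hst), fun r hr => hx.2 r ⟨hr.1, hr.2.trans hst⟩⟩

lemma IsTrajectory.apply_zero (hx : IsTrajectory f a x₀ t x) (ht : 0 ≤ t) : x 0 = x₀ := by
  simpa using hx.2 0 ⟨le_rfl, ht⟩

lemma IsTrajectory.intervalIntegrable (hf : Continuous fun p : E n × E m => f p.1 p.2)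
    (ha : InUnitBall a) (hm : AEStronglyMeasurable a (volume.restrict (Ici (0 : ℝ))))
    (ht : 0 ≤ t) (hx : IsTrajectory f a x₀ t x) :
    IntervalIntegrable (fun r => f (x r) (a r)) volume 0 t := by
  obtain ⟨C, hC⟩ := ((isCompact_Icc.image_of_continuousOn hx.1).prod
    (isCompact_closedBall (0 : E m) 1)).exists_bound_of_continuousOn hf.continuousOn
  rw [intervalIntegrable_iff_integrableOn_Icc_of_le ht]
  have hmeas : AEStronglyMeasurable (fun r => f (x r) (a r)) (volume.restrict (Icc 0 t)) :=
    hf.comp_aestronglyMeasurable ((hx.1.aestronglyMeasurable measurableSet_Icc).prodMk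
      (hm.mono_measure (Measure.restrict_mono Icc_subset_Ici_self le_rfl)))
  refine Integrable.of_bound hmeas C ?_
  filter_upwards [ae_restrict_mem measurableSet_Icc] with r hr
  exact hC (x r, a r) ⟨mem_image_of_mem x hr, ha r hr.1⟩

lemma IsTrajectory.lipschitzOnWith (hf : Continuous fun p : E n × E m => f p.1 p.2)
    (ha : InUnitBall a) (hm : AEStronglyMeasurable a (volume.restrict (Ici (0 : ℝ))))
    (ht : 0 ≤ t) (hx : IsTrajectory f a x₀ t x) {M : ℝ} (hM0 : 0 ≤ M)
    (hM : ∀ s ∈ Ico 0 t, ‖f (x s) (a s)‖ ≤ M) :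
    LipschitzOnWith M.toNNReal x (Icc 0 t) := by
  have hint := hx.intervalIntegrable hf ha hm ht
  have hsub : ∀ s ∈ Icc 0 t, IntervalIntegrable (fun r => f (x r) (a r)) volume 0 s := fun s hs =>
    hint.mono_set (by rw [uIcc_of_le hs.1, uIcc_of_le ht]; exact Icc_subset_Icc_right hs.2)
  refine LipschitzOnWith.of_dist_le_mul fun s hs r hr => ?_
  rw [Real.coe_toNNReal _ hM0, dist_eq_norm, hx.2 s hs, hx.2 r hr, add_sub_add_left_eq_sub,
    intervalIntegral.integral_interval_sub_left (hsub s hs) (hsub r hr), Real.dist_eq]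
  refine intervalIntegral.norm_integral_le_of_norm_le_const_ae ?_
  -- The speed bound is not assumed at the final time; this is what allows `t` to be a first exit
  -- time in `IsTrajectory.mem_ball`.
  have : ∀ᵐ q : ℝ, q ≠ t := by simp [ae_iff, measure_singleton]
  filter_upwards [this] with q hqt hq
  rw [uIoc, mem_Ioc] at hq
  exact hM q ⟨(le_min hr.1 hs.1).trans hq.1.le,
    lt_of_le_of_ne (hq.2.trans (max_le hr.2 hs.2)) hqt⟩

lemma IsTrajectory.ae_hasDerivAt (hf : Continuous fun p : E n × E m => f p.1 p.2)
    (ha : InUnitBall a) (hm : AEStronglyMeasurable a (volume.restrict (Ici (0 : ℝ))))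
    (ht : 0 ≤ t) (hx : IsTrajectory f a x₀ t x) :
    ∀ᵐ s, s ∈ Ioo 0 t → HasDerivAt x (f (x s) (a s)) s := by
  filter_upwards [(hx.intervalIntegrable hf ha hm ht).ae_hasDerivAt_integral] with s hs hst
  rw [uIcc_of_le ht] at hs
  refine ((hs (Ioo_subset_Icc_self hst) 0 ⟨le_rfl, ht⟩).const_add x₀).congr_of_eventuallyEq ?_
  filter_upwards [Ioo_mem_nhds hst.1 hst.2] with r hr
  exact hx.2 r (Ioo_subset_Icc_self hr)

/-- A trajectory with speed at most `M` in a ball does not leave it before the time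
needed to reach its boundary. -/
lemma IsTrajectory.mem_ball (hf : Continuous fun p : E n × E m => f p.1 p.2)
    (ha : InUnitBall a) (hm : AEStronglyMeasurable a (volume.restrict (Ici (0 : ℝ))))
    (hx : IsTrajectory f a x₀ t x) {M R : ℝ} {c : E n} (hM0 : 0 ≤ M)
    (hM : ∀ y ∈ Metric.ball c R, ∀ b ∈ Metric.closedBall (0 : E m) 1, ‖f y b‖ ≤ M)
    (hR : dist x₀ c + M * t < R) : ∀ s ∈ Icc 0 t, x s ∈ Metric.ball c R := by
  by_contra! hcon
  obtain ⟨s₀, hs₀, hout⟩ := hcon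
  have hdist : ContinuousOn (fun s => dist (x s) c) (Icc 0 t) :=
    continuous_dist.comp_continuousOn (hx.1.prodMk continuousOn_const)
  have hcpt : IsCompact (Icc 0 t ∩ (fun s => dist (x s) c) ⁻¹' Ici R) :=
    isCompact_Icc.of_isClosed_subset (hdist.preimage_isClosed_of_isClosed isClosed_Icc isClosed_Ici)
      inter_subset_left
  obtain ⟨s, ⟨hs, hsR⟩, hmin⟩ := hcpt.exists_isLeast ⟨s₀, hs₀, by simpa using hout⟩
  have hlip := (hx.mono hs.2).lipschitzOnWith hf ha hm hs.1 hM0 fun r hr => by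
    refine hM _ ?_ _ (ha r hr.1)
    by_contra hr'
    exact (hmin ⟨⟨hr.1, hr.2.le.trans hs.2⟩, by simpa using hr'⟩).not_gt hr.2
  have h := hlip.dist_le_mul s ⟨hs.1, le_rfl⟩ 0 ⟨le_rfl, hs.1⟩
  rw [hx.apply_zero (hs.1.trans hs.2), Real.coe_toNNReal _ hM0, Real.dist_eq, sub_zero,
    abs_of_nonneg hs.1] at h
  have h1 : R ≤ dist (x s) c := hsR
  have h2 := dist_triangle (x s) x₀ c
  have h3 := mul_le_mul_of_nonneg_left hs.2 hM0
  linarith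

/-- Viewing the primitive of the control as a trajectory of ẇ = a lets the Lipschitz and a.e.
differentiability lemmas apply to the pair (x, w). -/
lemma isTrajectory_integral {a : ℝ → E m} (ha : InUnitBall a)
    (hm : AEStronglyMeasurable a (volume.restrict (Ici (0 : ℝ)))) (t : ℝ) :
    IsTrajectory (fun (_ : E m) b => b) a 0 t (fun s => ∫ r in (0 : ℝ)..s, a r) := by
  refine ⟨?_, fun s _ => by simp⟩
  rcases le_or_gt 0 t with ht | ht
  · rw [← uIcc_of_le ht]
    refine intervalIntegral.continuousOn_primitive_interval ?_
    rw [uIcc_of_le ht]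
    refine Integrable.of_bound
      (hm.mono_measure (Measure.restrict_mono Icc_subset_Ici_self le_rfl)) 1 ?_
    filter_upwards [ae_restrict_mem measurableSet_Icc] with r hr
    simpa using ha r hr.1
  · simp [Icc_eq_empty_of_lt ht]

end Trajectory

/-- A mean value inequality along Lipschitz curves. -/
lemma abs_sub_le_of_ae_abs_fderiv_le {F : Type*} [NormedAddCommGroup F] [NormedSpace ℝ F]
    [ProperSpace F] {Φ : F → ℝ} (hΦ : ContDiff ℝ 1 Φ) {y v : ℝ → F} {t c : ℝ} {L : NNReal}
    (ht : 0 ≤ t) (hy : LipschitzOnWith L y (Icc 0 t))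
    (hv : ∀ᵐ s, s ∈ Ioo 0 t → HasDerivAt y (v s) s)
    (hc : ∀ s ∈ Ioo 0 t, |fderiv ℝ Φ (y s) (v s)| ≤ c) :
    |Φ (y t) - Φ (y 0)| ≤ c * t := by
  obtain ⟨K, hK⟩ := (hΦ.locallyLipschitz.locallyLipschitzOn
    (s := y '' Icc 0 t)).exists_lipschitzOnWith_of_compact
      (isCompact_Icc.image_of_continuousOn hy.continuousOn)
  have hcomp : AbsolutelyContinuousOnInterval (Φ ∘ y) 0 t := by
    refine LipschitzOnWith.absolutelyContinuousOnInterval (K := K * L) ?_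
    rw [uIcc_of_le ht]
    exact hK.comp hy (mapsTo_image _ _)
  have hle : ‖∫ s in (0 : ℝ)..t, deriv (Φ ∘ y) s‖ ≤ c * |t - 0| := by
    refine intervalIntegral.norm_integral_le_of_norm_le_const_ae ?_
    have : ∀ᵐ q : ℝ, q ≠ t := by simp [ae_iff, measure_singleton]
    filter_upwards [hv, this] with s hs hst hs'
    rw [uIoc_of_le ht] at hs'
    have hmem : s ∈ Ioo 0 t := ⟨hs'.1, lt_of_le_of_ne hs'.2 hst⟩
    rw [((hΦ.differentiable one_ne_zero _).hasFDerivAt.comp_hasDerivAt s (hs hmem)).deriv]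
    exact hc s hmem
  rw [hcomp.integral_deriv_eq_sub, sub_zero, abs_of_nonneg ht] at hle
  exact hle

/-! ### The quadratic forms of `S` and `K` -/

section Algebra

variable {n m : ℕ}

/-- The linear form `b ↦ ∇u σ(x) b`. -/
def gradForm (u : E n → ℝ) (σ : E n → Matrix (Fin n) (Fin m) ℝ) (x : E n) : E m →L[ℝ] ℝ :=
  ∑ i, gradMul u σ x i • EuclideanSpace.proj i

/-- The bilinear form `(b, a) ↦ S(x) a · b`. -/
def formS (u : E n → ℝ) (σ : E n → Matrix (Fin n) (Fin m) ℝ) (x : E n) :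
    E m →L[ℝ] E m →L[ℝ] ℝ :=
  ∑ i, ∑ j, matS u σ x i j • (EuclideanSpace.proj i : E m →L[ℝ] ℝ).smulRight
    (EuclideanSpace.proj j : E m →L[ℝ] ℝ)

/-- The quadratic form of `K(x)`. -/
def quadK (u : E n → ℝ) (σ : E n → Matrix (Fin n) (Fin m) ℝ) (x : E n) (a b : E m) : ℝ :=
  formS u σ x a a + 2 * formS u σ x b a + formS u σ x b b

variable {u : E n → ℝ} {σ : E n → Matrix (Fin n) (Fin m) ℝ}

lemma gradForm_apply (x : E n) (b : E m) : gradForm u σ x b = ∑ i, gradMul u σ x i * b i := by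
  simp [gradForm]

lemma formS_apply (x : E n) (b a : E m) :
    formS u σ x b a = ∑ i, ∑ j, matS u σ x i j * (b i * a j) := by
  simp [formS]

lemma formS_eq_dotProduct (x : E n) (b a : E m) :
    formS u σ x b a = b.ofLp ⬝ᵥ (matS u σ x).mulVec a.ofLp := by
  simp only [formS_apply, dotProduct, Matrix.mulVec, Finset.mul_sum]
  exact Finset.sum_congr rfl fun i _ => Finset.sum_congr rfl fun j _ => by ring

lemma symField_eq_sum (x : E n) (a : E m) : symField σ x a = ∑ j, a j • column σ j x := by
  ext i
  simp [symField, column, Matrix.mulVec, dotProduct, mul_comm]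

lemma fderiv_symField (x : E n) (a : E m) :
    fderiv ℝ u x (symField σ x a) = gradForm u σ x a := by
  simp [symField_eq_sum, gradForm_apply, gradMul, mul_comm]

lemma contDiff_column (hσ : ∀ i j, ContDiff ℝ 2 (fun x => σ x i j)) (j : Fin m) :
    ContDiff ℝ 2 (column σ j) :=
  contDiff_euclidean.2 fun i => hσ i j

lemma contDiff_symField (hσ : ∀ i j, ContDiff ℝ 2 (fun x => σ x i j)) (a : E m) :
    ContDiff ℝ 2 (fun x => symField σ x a) := by
  simp only [symField_eq_sum]
  exact ContDiff.sum fun j _ => (contDiff_column hσ j).const_smul (a j)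

lemma continuous_symField (hσ : ∀ i j, ContDiff ℝ 2 (fun x => σ x i j)) :
    Continuous fun p : E n × E m => symField σ p.1 p.2 := by
  simp only [symField_eq_sum]
  exact continuous_finsetSum _ fun j _ => (by fun_prop : Continuous fun p : E n × E m => p.2 j).smul
    ((contDiff_column hσ j).continuous.comp continuous_fst)

lemma contDiff_gradMul (hσ : ∀ i j, ContDiff ℝ 2 (fun x => σ x i j)) (hu : ContDiff ℝ 3 u)
    (i : Fin m) : ContDiff ℝ 2 (fun x => gradMul u σ x i) :=
  (hu.fderiv_right (m := 2) (by norm_num)).clm_apply (contDiff_column hσ i)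

lemma contDiff_gradForm (hσ : ∀ i j, ContDiff ℝ 2 (fun x => σ x i j)) (hu : ContDiff ℝ 3 u) :
    ContDiff ℝ 2 (gradForm u σ) :=
  ContDiff.sum fun i _ => (contDiff_gradMul hσ hu i).smul contDiff_const

lemma fderiv_gradForm (hσ : ∀ i j, ContDiff ℝ 2 (fun x => σ x i j)) (hu : ContDiff ℝ 3 u)
    (x : E n) (b a : E m) :
    fderiv ℝ (fun y => gradForm u σ y b) x (symField σ x a) = formS u σ x b a := by
  have hd : ∀ i, DifferentiableAt ℝ (fun y => gradMul u σ y i) x := fun i =>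
    ((contDiff_gradMul hσ hu i).differentiable two_ne_zero) x
  simp only [gradForm_apply]
  rw [fderiv_fun_sum fun i _ => (hd i).mul_const (b i)]
  simp only [sum_apply, formS_apply, symField_eq_sum, map_sum, map_smul,
    fderiv_mul_const (hd _), smul_apply, smul_eq_mul, matS, Matrix.of_apply,
    Finset.mul_sum]
  rw [Finset.sum_comm]
  exact Finset.sum_congr rfl fun i _ => Finset.sum_congr rfl fun j _ => by ring

lemma continuous_formS (hσ : ∀ i j, ContDiff ℝ 2 (fun x => σ x i j)) (hu : ContDiff ℝ 3 u) :
    Continuous (formS u σ) := by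
  refine continuous_clm_apply.2 fun b => continuous_clm_apply.2 fun a => ?_
  simp only [formS_apply]
  refine continuous_finsetSum _ fun i _ => continuous_finsetSum _ fun j _ => Continuous.mul ?_
    continuous_const
  exact ((contDiff_gradMul hσ hu i).continuous_fderiv two_ne_zero).clm_apply
    (contDiff_column hσ j).continuous

lemma formS_eq_hessian_add (hσ : ∀ i j, ContDiff ℝ 2 (fun x => σ x i j)) (hu : ContDiff ℝ 3 u)
    (x : E n) (b a : E m) :
    formS u σ x b a = fderiv ℝ (fderiv ℝ u) x (symField σ x a) (symField σ x b)
      + fderiv ℝ u x (fderiv ℝ (fun y => symField σ y b) x (symField σ x a)) := by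
  rw [← fderiv_gradForm hσ hu]
  simp only [← fderiv_symField]
  rw [fderiv_clm_apply ((hu.fderiv_right (m := 2) (by norm_num)).differentiable two_ne_zero x)
    ((contDiff_symField hσ b).differentiable two_ne_zero x)]
  simp [add_comm]

/-- In Dg g + [g₁,g₂] the bracket trades the cross term Dg₁ g₂ for a second copy of Dg₂ g₁. Together
with the symmetry of D²u this turns the mixed terms into 2 S a·b. -/
lemma secondOrderTerm_eq (hσ : ∀ i j, ContDiff ℝ 2 (fun x => σ x i j)) (hu : ContDiff ℝ 3 u)
    (x : E n) (a b : E m) :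
    secondOrderTerm (symField σ) u x a b = - quadK u σ x a b := by
  have hd : ∀ a, DifferentiableAt ℝ (fun y => symField σ y a) x := fun a =>
    (contDiff_symField hσ a).differentiable two_ne_zero x
  have hsymm : fderiv ℝ (fderiv ℝ u) x (symField σ x a) (symField σ x b)
      = fderiv ℝ (fderiv ℝ u) x (symField σ x b) (symField σ x a) :=
    (hu.contDiffAt.isSymmSndFDerivAt (by
      rw [minSmoothness_of_isRCLikeNormedField]; exact mod_cast (by norm_num : 2 ≤ 3))).eq _ _
  simp only [secondOrderTerm, quadK, VectorField.lieBracket, fderiv_fun_add (hd a) (hd b),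
    formS_eq_hessian_add hσ hu, map_add, map_sub, add_apply]
  linarith

lemma matK_isSymm (x : E n) : (matK u σ x).IsSymm := by
  have : (matSsym u σ x).IsSymm := by
    simp [matSsym, Matrix.IsSymm, add_comm]
  exact Matrix.isSymm_fromBlocks_iff.2 ⟨this, by simp, by simp, this⟩

lemma dotProduct_matK_mulVec (x : E n) (a b : E m) :
    Sum.elim a.ofLp b.ofLp ⬝ᵥ (matK u σ x).mulVec (Sum.elim a.ofLp b.ofLp) = quadK u σ x a b := by
  have h : ∀ v w : Fin m → ℝ, v ⬝ᵥ (matS u σ x).transpose.mulVec w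
      = w ⬝ᵥ (matS u σ x).mulVec v := fun v w => by
    rw [Matrix.mulVec_transpose, dotProduct_comm, ← Matrix.dotProduct_mulVec]
  simp only [matK, quadK, matSsym, formS_eq_dotProduct, Matrix.fromBlocks_mulVec,
    Sum.elim_comp_inl, Sum.elim_comp_inr, sumElim_dotProduct_sumElim, dotProduct_add,
    Matrix.smul_mulVec, Matrix.add_mulVec, dotProduct_smul, smul_eq_mul, h]
  ring

lemma hasNegEigenvalue_iff {ι : Type} [Fintype ι] [DecidableEq ι] {M : Matrix ι ι ℝ}
    (hM : M.IsSymm) : HasNegEigenvalue M ↔ ∃ v, v ⬝ᵥ M.mulVec v < 0 := by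
  have hH : M.IsHermitian := by
    rwa [Matrix.IsHermitian, Matrix.conjTranspose_eq_transpose_of_trivial]
  constructor
  · rintro ⟨μ, hμ, hev⟩
    obtain ⟨v, hv⟩ := hev.exists_hasEigenvector
    refine ⟨v, ?_⟩
    have h := hv.apply_eq_smul
    rw [Matrix.toLin'_apply] at h
    rw [h, dotProduct_smul, smul_eq_mul]
    refine mul_neg_of_neg_of_pos hμ ?_
    have := Matrix.dotProduct_star_self_pos_iff.2 hv.2
    simpa using this
  · rintro ⟨v, hv⟩
    by_contra hno
    have hps : M.PosSemidef := hH.posSemidef_iff_eigenvalues_nonneg.2 fun i => by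
      by_contra hneg
      refine hno ⟨_, not_le.1 hneg, Module.End.hasEigenvalue_of_hasEigenvector
        (x := (hH.eigenvectorBasis i).ofLp) ⟨?_, ?_⟩⟩
      · rw [Module.End.mem_eigenspace_iff, Matrix.toLin'_apply]
        exact hH.mulVec_eigenvectorBasis i
      · intro h0
        exact hH.eigenvectorBasis.toBasis.ne_zero i (by ext j; simpa using congrFun h0 j)
    have := hps.dotProduct_mulVec_nonneg v
    rw [star_trivial] at this
    exact this.not_gt hv

lemma hasNegEigenvalue_matK_iff (x : E n) :
    HasNegEigenvalue (matK u σ x) ↔ ∃ a b : E m, quadK u σ x a b < 0 := by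
  rw [hasNegEigenvalue_iff (matK_isSymm x)]
  constructor
  · rintro ⟨v, hv⟩
    refine ⟨WithLp.toLp 2 (v ∘ Sum.inl), WithLp.toLp 2 (v ∘ Sum.inr), ?_⟩
    rw [← dotProduct_matK_mulVec]
    simpa using hv
  · rintro ⟨a, b, h⟩
    exact ⟨_, by rwa [dotProduct_matK_mulVec]⟩

lemma quadK_smul (x : E n) (c : ℝ) (a b : E m) :
    quadK u σ x (c • a) (c • b) = c ^ 2 * quadK u σ x a b := by
  simp [quadK]
  ring

/-- The form is homogeneous of degree two, so a pair with a negative value can be shrunk into the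
unit ball. -/
lemma exists_quadK_neg_iff (x : E n) :
    (∃ a b : E m, quadK u σ x a b < 0) ↔ ∃ a ∈ Metric.closedBall (0 : E m) 1,
      ∃ b ∈ Metric.closedBall (0 : E m) 1, quadK u σ x a b < 0 := by
  refine ⟨?_, fun ⟨a, _, b, _, h⟩ => ⟨a, b, h⟩⟩
  rintro ⟨a, b, h⟩
  have hpos : 0 < 1 + ‖a‖ + ‖b‖ := by positivity
  have hc : 0 < (1 + ‖a‖ + ‖b‖)⁻¹ := inv_pos.2 hpos
  refine ⟨(1 + ‖a‖ + ‖b‖)⁻¹ • a, ?_, (1 + ‖a‖ + ‖b‖)⁻¹ • b, ?_, ?_⟩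
  · rw [mem_closedBall_zero_iff, norm_smul, Real.norm_of_nonneg hc.le, inv_mul_le_one₀ hpos]
    linarith [norm_nonneg b]
  · rw [mem_closedBall_zero_iff, norm_smul, Real.norm_of_nonneg hc.le, inv_mul_le_one₀ hpos]
    linarith [norm_nonneg a]
  · rw [quadK_smul]
    exact mul_neg_of_pos_of_neg (by positivity) h

lemma secondOrderCondition_iff (hσ : ∀ i j, ContDiff ℝ 2 (fun x => σ x i j))
    (hu : ContDiff ℝ 3 u) (x : E n) :
    SecondOrderCondition (symField σ) u x ↔ ∃ a b : E m, quadK u σ x a b < 0 := by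
  rw [exists_quadK_neg_iff]
  constructor
  · rintro ⟨M, ⟨⟨⟨a, b⟩, ⟨ha, hb⟩, rfl⟩, _⟩, hM⟩
    simp only [secondOrderTerm_eq hσ hu] at hM
    exact ⟨a, ha, b, hb, by linarith⟩
  · rintro ⟨a, ha, b, hb, h⟩
    have hcont : Continuous fun p : E m × E m => secondOrderTerm (symField σ) u x p.1 p.2 := by
      simp only [secondOrderTerm_eq hσ hu, quadK]
      fun_prop
    obtain ⟨M, hM⟩ := (((isCompact_closedBall (0 : E m) 1).prod
      (isCompact_closedBall (0 : E m) 1)).image hcont).exists_isGreatest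
        ⟨_, mem_image_of_mem _ (mk_mem_prod ha hb)⟩
    refine ⟨M, hM, lt_of_lt_of_le ?_ (hM.2 (mem_image_of_mem _ (mk_mem_prod ha hb)))⟩
    simp only [secondOrderTerm_eq hσ hu]
    linarith

end Algebra

/-! ### Second order expansion along trajectories -/

section Expansion

variable {n m : ℕ} {u : E n → ℝ} {σ : E n → Matrix (Fin n) (Fin m) ℝ}

lemma IsTrajectory.exists_lipschitzOnWith {f : E n → E m → E n} {a : ℝ → E m} {x₀ : E n} {t : ℝ}
    {x : ℝ → E n} (hf : Continuous fun p : E n × E m => f p.1 p.2)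
    (ha : InUnitBall a) (hm : AEStronglyMeasurable a (volume.restrict (Ici (0 : ℝ))))
    (ht : 0 ≤ t) (hx : IsTrajectory f a x₀ t x) : ∃ L, LipschitzOnWith L x (Icc 0 t) := by
  obtain ⟨C, hC⟩ := ((isCompact_Icc.image_of_continuousOn hx.1).prod
    (isCompact_closedBall (0 : E m) 1)).exists_bound_of_continuousOn hf.continuousOn
  refine ⟨_, hx.lipschitzOnWith hf ha hm ht (abs_nonneg C) fun s hs => ?_⟩
  exact (hC (x s, a s) ⟨mem_image_of_mem x (Ico_subset_Icc_self hs), ha s hs.1⟩).trans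
    (le_abs_self C)

/-- Expansion of `∇u σ` along a trajectory that stays where `S` is `ε`-close to `S(c)`. -/
lemma IsTrajectory.abs_gradForm_sub_le (hσ : ∀ i j, ContDiff ℝ 2 (fun x => σ x i j))
    (hu : ContDiff ℝ 3 u) {a : ℝ → E m} {x₀ c : E n} {t ε : ℝ} {x : ℝ → E n}
    (ha : InUnitBall a) (hm : AEStronglyMeasurable a (volume.restrict (Ici (0 : ℝ))))
    (ht : 0 ≤ t) (hx : IsTrajectory (symField σ) a x₀ t x)
    (hε : ∀ s ∈ Icc 0 t, ‖formS u σ (x s) - formS u σ c‖ ≤ ε) {b : E m} (hb : ‖b‖ ≤ 1) :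
    |gradForm u σ (x t) b - gradForm u σ x₀ b - formS u σ c b (∫ r in (0 : ℝ)..t, a r)|
      ≤ ε * t := by
  have hw := isTrajectory_integral ha hm t
  have hf := continuous_symField hσ
  obtain ⟨L, hL⟩ := hx.exists_lipschitzOnWith hf ha hm ht
  obtain ⟨L', hL'⟩ := hw.exists_lipschitzOnWith continuous_snd ha hm ht
  have hg : ContDiff ℝ 2 fun y => gradForm u σ y b :=
    (contDiff_gradForm hσ hu).clm_apply contDiff_const
  -- Along (x, w) this function has derivative (S(x) - S(c)) a·b, at most ε in absolute value.
  have hΦ : ContDiff ℝ 1 fun p : E n × E m => gradForm u σ p.1 b - formS u σ c b p.2 :=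
    ((hg.of_le one_le_two).comp contDiff_fst).sub ((formS u σ c b).contDiff.comp contDiff_snd)
  have key := abs_sub_le_of_ae_abs_fderiv_le (c := ε) (v := fun s => (symField σ (x s) (a s), a s))
    hΦ ht (hL.prodMk hL') (by
      filter_upwards [hx.ae_hasDerivAt hf ha hm ht, hw.ae_hasDerivAt continuous_snd ha hm ht]
        with s h₁ h₂ hs using (h₁ hs).prodMk (h₂ hs)) fun s hs => by
      have hd₁ : HasFDerivAt (fun p : E n × E m => gradForm u σ p.1 b)
          ((fderiv ℝ (fun y => gradForm u σ y b) (x s)).comp (ContinuousLinearMap.fst ℝ _ _))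
          (x s, ∫ r in (0 : ℝ)..s, a r) :=
        HasFDerivAt.comp (g := fun y => gradForm u σ y b) _
          (hg.differentiable two_ne_zero _).hasFDerivAt hasFDerivAt_fst
      have hd := hd₁.fun_sub ((formS u σ c b).hasFDerivAt.comp
        (x s, ∫ r in (0 : ℝ)..s, a r) hasFDerivAt_snd)
      simp only [Function.comp_def] at hd
      rw [hd.fderiv]
      have has : ‖a s‖ ≤ 1 := by simpa using ha s hs.1.le
      have h := (formS u σ (x s) - formS u σ c).le_opNorm₂ b (a s)
      have h' : ‖formS u σ (x s) - formS u σ c‖ * ‖b‖ * ‖a s‖ ≤ ε * 1 * 1 := by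
        have := hε s (Ioo_subset_Icc_self hs)
        have := (ContinuousLinearMap.opNorm_nonneg _).trans this
        gcongr
      simp only [sub_apply, ContinuousLinearMap.comp_apply, ContinuousLinearMap.coe_fst',
        ContinuousLinearMap.coe_snd', fderiv_gradForm hσ hu]
      rw [Real.norm_eq_abs] at h
      simp only [sub_apply] at h
      linarith
  have h0 := hx.apply_zero ht
  simp only [h0, intervalIntegral.integral_same, map_zero, sub_zero] at key
  rwa [sub_right_comm]

/-- Second order expansion of `u` along a trajectory that stays where `S` is `ε`-close to `S(c)`,
provided that `S(c)` is symmetric on the values of the control and of its primitive. -/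
lemma IsTrajectory.abs_sub_le (hσ : ∀ i j, ContDiff ℝ 2 (fun x => σ x i j))
    (hu : ContDiff ℝ 3 u) {a : ℝ → E m} {x₀ c : E n} {t ε : ℝ} {x : ℝ → E n}
    (ha : InUnitBall a) (hm : AEStronglyMeasurable a (volume.restrict (Ici (0 : ℝ))))
    (ht : 0 ≤ t) (hx : IsTrajectory (symField σ) a x₀ t x)
    (hε : ∀ s ∈ Icc 0 t, ‖formS u σ (x s) - formS u σ c‖ ≤ ε)
    (hsymm : ∀ s ∈ Icc 0 t, formS u σ c (∫ r in (0 : ℝ)..s, a r) (a s)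
      = formS u σ c (a s) (∫ r in (0 : ℝ)..s, a r)) :
    |u (x t) - u x₀ - gradForm u σ x₀ (∫ r in (0 : ℝ)..t, a r)
      - 1 / 2 * formS u σ c (∫ r in (0 : ℝ)..t, a r) (∫ r in (0 : ℝ)..t, a r)| ≤ ε * t ^ 2 := by
  have hw := isTrajectory_integral ha hm t
  have hf := continuous_symField hσ
  obtain ⟨L, hL⟩ := hx.exists_lipschitzOnWith hf ha hm ht
  obtain ⟨L', hL'⟩ := hw.exists_lipschitzOnWith continuous_snd ha hm ht
  have hu1 : ContDiff ℝ 1 u := hu.of_le (mod_cast (by norm_num : 1 ≤ 3))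
  -- By `hsymm` the quadratic term has derivative S(c)w·a along w. The total derivative is then the
  -- remainder of `abs_gradForm_sub_le` at time s with b = a(s), hence at most ε s.
  have hΦ : ContDiff ℝ 1 fun p : E n × E m =>
      u p.1 - gradForm u σ x₀ p.2 - 1 / 2 * formS u σ c p.2 p.2 :=
    ((hu1.comp contDiff_fst).sub ((gradForm u σ x₀).contDiff.comp contDiff_snd)).sub
      (contDiff_const.mul
        (((formS u σ c).contDiff.comp contDiff_snd).clm_apply contDiff_snd))
  have key := abs_sub_le_of_ae_abs_fderiv_le (c := ε * t)
    (v := fun s => (symField σ (x s) (a s), a s))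
    hΦ ht (hL.prodMk hL') (by
      filter_upwards [hx.ae_hasDerivAt hf ha hm ht, hw.ae_hasDerivAt continuous_snd ha hm ht]
        with s h₁ h₂ hs using (h₁ hs).prodMk (h₂ hs)) fun s hs => by
      have hd₁ : HasFDerivAt (fun p : E n × E m => u p.1)
          ((fderiv ℝ u (x s)).comp (ContinuousLinearMap.fst ℝ _ _))
          (x s, ∫ r in (0 : ℝ)..s, a r) :=
        HasFDerivAt.comp (g := u) _
          (hu1.differentiable one_ne_zero _).hasFDerivAt hasFDerivAt_fst
      have hd := (hd₁.fun_sub ((gradForm u σ x₀).hasFDerivAt.comp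
        (x s, ∫ r in (0 : ℝ)..s, a r) hasFDerivAt_snd)).fun_sub
          (((formS u σ c).hasFDerivAt_of_bilinear hasFDerivAt_snd hasFDerivAt_snd).const_mul
            (1 / 2))
      simp only [Function.comp_def] at hd
      rw [hd.fderiv]
      have has : ‖a s‖ ≤ 1 := by simpa using ha s hs.1.le
      have hs' := Ioo_subset_Icc_self hs
      have hε0 : 0 ≤ ε := (ContinuousLinearMap.opNorm_nonneg _).trans (hε s hs')
      have h := (hx.mono hs'.2).abs_gradForm_sub_le hσ hu ha hm hs'.1
        (fun r hr => hε r ⟨hr.1, hr.2.trans hs'.2⟩) has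
      have h' : ε * s ≤ ε * t := mul_le_mul_of_nonneg_left hs'.2 hε0
      simp only [sub_apply, add_apply, smul_apply, smul_eq_mul, ContinuousLinearMap.comp_apply,
        ContinuousLinearMap.coe_fst', ContinuousLinearMap.coe_snd', fderiv_symField,
        ContinuousLinearMap.precompR_apply, ContinuousLinearMap.precompL_apply,
        ContinuousLinearMap.compL_apply, hsymm s hs']
      refine le_trans (le_of_eq ?_) (h.trans h')
      ring_nf
  have h0 := hx.apply_zero ht
  simp only [h0, intervalIntegral.integral_same, map_zero, sub_zero, mul_zero] at key
  calc _ = _ := by ring_nf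
    _ ≤ _ := key
    _ = _ := by ring

end Expansion

/-! ### Reachability with two constant controls -/

section Reach

variable {n m : ℕ}

lemma minTime_le {f : E n → E m → E n} {𝒰 : Set (ℝ → E m)} {target : Set (E n)} {x₀ : E n}
    {a : ℝ → E m} (ha : a ∈ 𝒰) {t : ℝ} (ht : 0 ≤ t) {x : ℝ → E n} (hx : IsTrajectory f a x₀ t x)
    (hxt : x t ∈ target) : minTime f 𝒰 target x₀ ≤ ENNReal.ofReal t :=
  iInf₂_le_of_le a ha (sInf_le ⟨t, ht, rfl, x, hx, hxt⟩)

/-- Concatenation of two trajectories. -/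
lemma IsTrajectory.trans {f : E n → E m → E n} (hf : Continuous fun p : E n × E m => f p.1 p.2)
    {a b : ℝ → E m} (ha : InUnitBall a) (hb : InUnitBall b)
    (hma : AEStronglyMeasurable a (volume.restrict (Ici (0 : ℝ))))
    (hmb : AEStronglyMeasurable b (volume.restrict (Ici (0 : ℝ)))) {x₀ : E n} {s t : ℝ}
    (hs : 0 ≤ s) (ht : 0 ≤ t) {x y : ℝ → E n}
    (hx : IsTrajectory f a x₀ s x) (hy : IsTrajectory f b (x s) t y) :
    IsTrajectory f (fun r => if r < s then a r else b (r - s)) x₀ (s + t)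
      (fun r => if r ≤ s then x r else y (r - s)) := by
  have hy0 : y 0 = x s := hy.apply_zero ht
  have hright : EqOn (fun r => if r ≤ s then x r else y (r - s)) (fun r => y (r - s))
      (Icc s (s + t)) := fun r hr => by
    rcases eq_or_lt_of_le hr.1 with rfl | h
    · simp [hy0]
    · simp [h.not_ge]
  refine ⟨?_, ?_⟩
  · rw [← Icc_union_Icc_eq_Icc hs (le_add_of_nonneg_right ht)]
    refine ContinuousOn.union_of_isClosed (hx.1.congr fun r hr => if_pos hr.2)
      (ContinuousOn.congr ?_ hright) isClosed_Icc isClosed_Icc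
    exact hy.1.comp (by fun_prop) fun r hr => ⟨by linarith [hr.1], by linarith [hr.2]⟩
  · have hne : ∀ᵐ q : ℝ, q ≠ s := by simp [ae_iff, measure_singleton]
    have hleft : ∀ r ∈ Icc 0 s, (fun q => f (if q ≤ s then x q else y (q - s))
        (if q < s then a q else b (q - s))) =ᵐ[volume.restrict (uIoc 0 r)]
        fun q => f (x q) (a q) := fun r hr => by
      filter_upwards [ae_restrict_mem measurableSet_uIoc, ae_restrict_of_ae hne] with q hq hqs
      rw [uIoc_of_le hr.1] at hq
      have hq' := hq.2.trans hr.2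
      rw [if_pos hq', if_pos (lt_of_le_of_ne hq' hqs)]
    have hmid : ∀ r ∈ Icc s (s + t), (fun q => f (if q ≤ s then x q else y (q - s))
        (if q < s then a q else b (q - s))) =ᵐ[volume.restrict (uIoc s r)]
        fun q => f (y (q - s)) (b (q - s)) := fun r hr => by
      filter_upwards [ae_restrict_mem measurableSet_uIoc] with q hq
      rw [uIoc_of_le hr.1] at hq
      rw [if_neg hq.1.not_ge, if_neg hq.1.not_gt]
    intro r hr
    rcases le_or_gt r s with hrs | hrs
    · simp only [if_pos hrs]
      rw [hx.2 r ⟨hr.1, hrs⟩, intervalIntegral.integral_congr_ae_restrict (hleft r ⟨hr.1, hrs⟩)]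
    · have hr' : r ∈ Icc s (s + t) := ⟨hrs.le, hr.2⟩
      have hrs' : r - s ∈ Icc 0 t := ⟨by linarith, by linarith [hr.2]⟩
      have hi₁ := (hx.intervalIntegrable hf ha hma hs).congr_ae (hleft s ⟨hs, le_rfl⟩).symm
      have hi₂ := (hy.mono hrs'.2).intervalIntegrable hf hb hmb hrs'.1
      have hi₃ := hi₂.comp_sub_right s
      rw [zero_add, sub_add_cancel] at hi₃
      rw [← intervalIntegral.integral_add_adjacent_intervals hi₁
        (hi₃.congr_ae (hmid r hr').symm),
        intervalIntegral.integral_congr_ae_restrict (hleft s ⟨hs, le_rfl⟩),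
        intervalIntegral.integral_congr_ae_restrict (hmid r hr'),
        intervalIntegral.integral_comp_sub_right (fun q => f (y q) (b q)), sub_self, ← add_assoc,
        ← hx.2 s ⟨hs, le_rfl⟩, ← hy.2 _ hrs']
      simp [hrs.not_ge]

lemma inUnitBall_const {a : E m} (ha : ‖a‖ ≤ 1) : InUnitBall fun _ => a := fun _ _ => by
  simpa using ha

/-- Local existence of trajectories with a constant control. -/
lemma exists_isTrajectory_const {f : E n → E m → E n} {a : E m}
    (hf : ContDiff ℝ 1 fun x => f x a) (c : E n) :
    ∃ δ > 0, ∀ x ∈ Metric.ball c δ, ∀ t ∈ Icc 0 δ, ∃ y, IsTrajectory f (fun _ => a) x t y := by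
  obtain ⟨r, hr, ε, hε, H⟩ :=
    hf.contDiffAt.exists_forall_mem_closedBall_exists_eq_forall_mem_Ioo_hasDerivAt (x₀ := c) 0
  refine ⟨min r (ε / 2), by positivity, fun x hx t ht => ?_⟩
  obtain ⟨y, hy0, hy⟩ := H x (Metric.ball_subset_closedBall
    (Metric.ball_subset_ball (min_le_left _ _) hx))
  have hmem : ∀ s ∈ Icc 0 t, s ∈ Ioo (0 - ε) (0 + ε) := fun s hs =>
    ⟨by linarith [hs.1], by linarith [hs.2, ht.2.trans (min_le_right _ _)]⟩
  have hcont : ContinuousOn y (Icc 0 t) := fun s hs =>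
    (hy s (hmem s hs)).continuousAt.continuousWithinAt
  refine ⟨y, hcont, fun s hs => ?_⟩
  rw [intervalIntegral.integral_eq_sub_of_hasDerivAt
    (fun q hq => hy q (hmem q (by rw [uIcc_of_le hs.1] at hq; exact ⟨hq.1, hq.2.trans hs.2⟩))), hy0]
  · abel
  · refine ContinuousOn.intervalIntegrable (hf.continuous.comp_continuousOn (hcont.mono ?_))
    rw [uIcc_of_le hs.1]
    exact Icc_subset_Icc_right hs.2

variable {u : E n → ℝ} {σ : E n → Matrix (Fin n) (Fin m) ℝ}

set_option maxSynthPendingDepth 3 in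
lemma exists_ball_formS_bound (hσ : ∀ i j, ContDiff ℝ 2 (fun x => σ x i j))
    (hu : ContDiff ℝ 3 u) (c : E n) {ε : ℝ} (hε : 0 < ε) :
    ∃ R > 0, ∀ x ∈ Metric.ball c R, ‖formS u σ x - formS u σ c‖ ≤ ε := by
  obtain ⟨R, hR, h⟩ := Metric.continuous_iff.1 (continuous_formS hσ hu) c ε hε
  exact ⟨R, hR, fun x hx => by rw [← dist_eq_norm]; exact (h x hx).le⟩

lemma exists_symField_bound (hσ : ∀ i j, ContDiff ℝ 2 (fun x => σ x i j)) (c : E n) (R : ℝ) :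
    ∃ M ≥ 0, ∀ y ∈ Metric.ball c R, ∀ b ∈ Metric.closedBall (0 : E m) 1,
      ‖symField σ y b‖ ≤ M := by
  obtain ⟨M, hM⟩ := ((isCompact_closedBall c R).prod
    (isCompact_closedBall (0 : E m) 1)).exists_bound_of_continuousOn
      (continuous_symField hσ).continuousOn
  exact ⟨|M|, abs_nonneg M, fun y hy b hb =>
    (hM (y, b) ⟨Metric.ball_subset_closedBall hy, hb⟩).trans (le_abs_self M)⟩

/-- Trajectories with a constant control, and their expansion. -/
lemma exists_isTrajectory_const_expansion (hσ : ∀ i j, ContDiff ℝ 2 (fun x => σ x i j))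
    (hu : ContDiff ℝ 3 u) (c : E n) {a : E m} (ha : ‖a‖ ≤ 1) {ε η : ℝ} (hε : 0 < ε) (hη : 0 < η) :
    ∃ δ > 0, ∀ x ∈ Metric.ball c δ, ∀ t ∈ Icc 0 δ, ∃ y,
      IsTrajectory (symField σ) (fun _ => a) x t y ∧ y t ∈ Metric.ball c η ∧
      (∀ b, ‖b‖ ≤ 1 → |gradForm u σ (y t) b - gradForm u σ x b - t * formS u σ c b a| ≤ ε * t) ∧
      |u (y t) - u x - t * gradForm u σ x a - 1 / 2 * t ^ 2 * formS u σ c a a| ≤ ε * t ^ 2 := by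
  obtain ⟨δ, hδ, hex⟩ := exists_isTrajectory_const
    ((contDiff_symField hσ a).of_le one_le_two) c
  obtain ⟨R, hR, hS⟩ := exists_ball_formS_bound hσ hu c hε
  obtain ⟨M, hM0, hM⟩ := exists_symField_bound hσ c (min R η)
  have hRη : 0 < min R η := lt_min hR hη
  have hM1 : 0 < M + 2 := by linarith
  -- With ρ = min R η / (M + 2), the start is within ρ of c and the path length is at most Mρ; the
  -- total is below (M + 2)ρ = min R η.
  refine ⟨min δ (min R η / (M + 2)), lt_min hδ (div_pos hRη hM1), fun x hx t ht => ?_⟩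
  obtain ⟨y, hy⟩ := hex x (Metric.ball_subset_ball (min_le_left _ _) hx) t
    ⟨ht.1, ht.2.trans (min_le_left _ _)⟩
  have hball := inUnitBall_const ha
  have hm : AEStronglyMeasurable (fun _ : ℝ => a) (volume.restrict (Ici (0 : ℝ))) :=
    aestronglyMeasurable_const
  have hx' : dist x c < min R η / (M + 2) := lt_of_lt_of_le hx (min_le_right _ _)
  have ht' : t ≤ min R η / (M + 2) := ht.2.trans (min_le_right _ _)
  have hsum : dist x c + M * t < min R η := by
    have h1 : (M + 2) * (min R η / (M + 2)) = min R η := mul_div_cancel₀ _ hM1.ne'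
    have h2 := mul_le_mul_of_nonneg_left ht' hM0
    have h3 := div_pos hRη hM1
    nlinarith
  have hstay := hy.mem_ball (continuous_symField hσ) hball hm hM0 hM hsum
  have hS' : ∀ s ∈ Icc 0 t, ‖formS u σ (y s) - formS u σ c‖ ≤ ε := fun s hs =>
    hS _ (Metric.ball_subset_ball (min_le_left _ _) (hstay s hs))
  refine ⟨y, hy, Metric.ball_subset_ball (min_le_right _ _) (hstay t ⟨ht.1, le_rfl⟩),
    fun b hb => ?_, ?_⟩
  · simpa using hy.abs_gradForm_sub_le hσ hu hball hm ht.1 hS' hb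
  -- For a constant control the primitive is a multiple of the control, so the symmetry condition is
  -- automatic.
  · have h := hy.abs_sub_le hσ hu hball hm ht.1 hS' (by simp)
    simp only [intervalIntegral.integral_const, sub_zero, map_smul, smul_apply, smul_eq_mul] at h
    calc _ = _ := by ring_nf
      _ ≤ _ := h

lemma isPiecewiseConstant_ite (a b : E m) (s : ℝ) :
    IsPiecewiseConstant fun r => if r < s then a else b := by
  refine fun τ => ⟨{s}, fun p q _ hpq _ h => ?_⟩
  have hs : ¬ (p ≤ s ∧ s ≤ q) := by simpa using h s (Finset.mem_singleton_self s)
  by_cases hp : p < s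
  · have hq : q < s := by
      by_contra hq
      exact hs ⟨hp.le, not_lt.1 hq⟩
    simp [hp, hq]
  · have hq : ¬ q < s := fun hq => hp (hpq.trans_lt hq)
    simp [hp, hq]

/-- Using the control `a` and then `b`, both for the time `t`, changes `u` at second order by
the quadratic form of `K`. -/
lemma exists_isTrajectory_two_controls (hσ : ∀ i j, ContDiff ℝ 2 (fun x => σ x i j))
    (hu : ContDiff ℝ 3 u) (c : E n) {𝒰 : Set (ℝ → E m)} (h𝒰 : IsControlClass 𝒰) {a b : E m}
    (ha : ‖a‖ ≤ 1) (hb : ‖b‖ ≤ 1) {ε η : ℝ} (hε : 0 < ε) (hη : 0 < η) :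
    ∃ δ > 0, ∀ x ∈ Metric.ball c δ, ∀ t ∈ Icc 0 δ, ∃ v ∈ 𝒰, ∃ y,
      IsTrajectory (symField σ) v x (t + t) y ∧ y (t + t) ∈ Metric.ball c η ∧
      u (y (t + t)) ≤ u x + t * gradForm u σ x (a + b)
        + t ^ 2 * (1 / 2 * quadK u σ c a b + 3 * ε) := by
  -- The second leg is prepared first: its radius δ₂ is the ball in which the first leg must end.
  obtain ⟨δ₂, hδ₂, h₂⟩ := exists_isTrajectory_const_expansion hσ hu c hb hε hη
  obtain ⟨δ₁, hδ₁, h₁⟩ := exists_isTrajectory_const_expansion hσ hu c ha hε hδ₂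
  refine ⟨min δ₁ δ₂, lt_min hδ₁ hδ₂, fun x hx t ht => ?_⟩
  obtain ⟨y, hy, hyball, hyg, hyu⟩ := h₁ x (Metric.ball_subset_ball (min_le_left _ _) hx) t
    ⟨ht.1, ht.2.trans (min_le_left _ _)⟩
  obtain ⟨z, hz, hzball, -, hzu⟩ := h₂ (y t) hyball t ⟨ht.1, ht.2.trans (min_le_right _ _)⟩
  have htraj := hy.trans (continuous_symField hσ) (inUnitBall_const ha) (inUnitBall_const hb)
    aestronglyMeasurable_const aestronglyMeasurable_const ht.1 ht.1 hz
  have hend : (if t + t ≤ t then y (t + t) else z (t + t - t)) = z t := by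
    split_ifs with h
    · have ht0 : t = 0 := by linarith [ht.1]
      subst ht0
      simp [hz.apply_zero le_rfl]
    · simp
  refine ⟨_, h𝒰.piecewiseConstant_mem _ (isPiecewiseConstant_ite a b t) fun r _ => ?_, _, htraj,
    by rwa [hend], ?_⟩
  · split_ifs
    · simpa using ha
    · simpa using hb
  · rw [hend]
    have e₁ := (abs_le.1 (hyg b hb)).2
    have e₂ := (abs_le.1 hyu).2
    have e₃ := (abs_le.1 hzu).2
    -- The change of ∇uσ b during the first leg produces the cross term t² S a·b; this and the two
    -- expansions of u each cost ε t², whence 3ε.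
    have e₄ := mul_le_mul_of_nonneg_left e₁ ht.1
    rw [map_add, quadK]
    nlinarith

end Reach

/-! ### Hölder estimates of the minimum time -/

section MinTime

variable {n m : ℕ} {u : E n → ℝ} {σ : E n → Matrix (Fin n) (Fin m) ℝ} {c : E n}
  {target : Set (E n)} {𝒰 : Set (ℝ → E m)}

/-- For x near c, target points that almost realise the distance are also near c. There they satisfy
u ≤ u(c), and u is Lipschitz. -/
lemma exists_sub_le_mul_infDist (hu : ContDiff ℝ 1 u)
    (htarget : ∀ᶠ x in 𝓝 c, x ∈ target ↔ u x ≤ u c) :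
    ∃ L > 0, ∃ r > 0, ∀ x ∈ Metric.closedBall c r, u x - u c ≤ L * Metric.infDist x target := by
  obtain ⟨K, s, hs, hK⟩ := hu.contDiffAt.exists_lipschitzOnWith (x := c)
  obtain ⟨η, hη, hball⟩ := Metric.mem_nhds_iff.1 (inter_mem hs htarget)
  have hc : c ∈ target := (htarget.self_of_nhds).2 le_rfl
  -- Three quarters are spent: x to c, the distance to the target, and the slack in choosing y. `K +
  -- 1` is positive even if `K` is zero.
  refine ⟨K + 1, by positivity, η / 4, by positivity, fun x hx => ?_⟩
  have hxc : dist x c ≤ η / 4 := hx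
  have hinf := Metric.infDist_le_dist_of_mem (x := x) hc
  refine le_of_forall_pos_lt_add fun e he => ?_
  have hK1 : (0 : ℝ) < K + 1 := by positivity
  obtain ⟨y, hy, hxy⟩ := (Metric.infDist_lt_iff ⟨c, hc⟩).1
    (lt_add_of_pos_right (Metric.infDist x target)
      (lt_min (div_pos he hK1) (by positivity : 0 < η / 4)))
  have hyc : y ∈ Metric.ball c η := by
    have h1 := dist_triangle_left y c x
    have h2 := min_le_right (e / (K + 1)) (η / 4)
    exact Metric.mem_ball.2 (by linarith)
  have huy : u y ≤ u c := (hball hyc).2.1 hy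
  have hlip := hK.dist_le_mul x (hball (Metric.mem_ball.2 (by linarith))).1 y (hball hyc).1
  rw [Real.dist_eq] at hlip
  have h1 := le_abs_self (u x - u y)
  have h2 : dist x y < Metric.infDist x target + e / (K + 1) :=
    hxy.trans_le (by gcongr; exact min_le_left _ _)
  calc u x - u c ≤ K * dist x y := by linarith
    _ ≤ (K + 1) * dist x y := by gcongr; linarith
    _ < (K + 1) * (Metric.infDist x target + e / (K + 1)) := by gcongr
    _ = _ := by field_simp

/-- If the quadratic form of `K` takes a negative value, then the minimum time is bounded by the
square root of the distance from the target. -/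
theorem exists_minTime_le_sqrt_infDist (hσ : ∀ i j, ContDiff ℝ 2 (fun x => σ x i j))
    (hu : ContDiff ℝ 3 u) (htarget : ∀ᶠ x in 𝓝 c, x ∈ target ↔ u x ≤ u c)
    (h𝒰 : IsControlClass 𝒰) (hneg : ∃ a b : E m, quadK u σ c a b < 0) :
    ∃ C r : ℝ, 0 < C ∧ 0 < r ∧ ∀ x ∈ Metric.closedBall c r,
      minTime (symField σ) 𝒰 target x
        ≤ ENNReal.ofReal (C * Metric.infDist x target ^ (1 / 2 : ℝ)) := by
  obtain ⟨a, ha, b, hb, hq⟩ := (exists_quadK_neg_iff c).1 hneg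
  rw [mem_closedBall_zero_iff] at ha hb
  set ρ := -quadK u σ c a b with hρdef
  have hρ : 0 < ρ := by linarith
  obtain ⟨η, hη, hηt⟩ := Metric.mem_nhds_iff.1 htarget
  obtain ⟨L, hL, r₀, hr₀, hLd⟩ :=
    exists_sub_le_mul_infDist (hu.of_le (mod_cast (by norm_num : 1 ≤ 3))) htarget
  obtain ⟨δ₁, hδ₁, h₁⟩ := exists_isTrajectory_two_controls hσ hu c h𝒰 ha hb
    (ε := ρ / 12) (by positivity) hη
  obtain ⟨δ₂, hδ₂, h₂⟩ := exists_isTrajectory_two_controls hσ hu c h𝒰 (a := -a) (b := -b)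
    (by simpa using ha) (by simpa using hb) (ε := ρ / 12) (by positivity) hη
  have hq' : quadK u σ c (-a) (-b) = quadK u σ c a b := by simp [quadK]
  have hc : c ∈ target := (htarget.self_of_nhds).2 le_rfl
  set δ := min δ₁ δ₂ with hδdef
  have hδ : 0 < δ := lt_min hδ₁ hδ₂
  -- The pair (a,b) or (-a,-b) is chosen so that the first order term is nonpositive. With ε = ρ/12
  -- the second order coefficient is -ρ/2 + ρ/4 = -ρ/4.
  have hreach : ∀ x ∈ Metric.ball c δ, ∀ t ∈ Icc 0 δ, u x - u c ≤ ρ / 4 * t ^ 2 →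
      minTime (symField σ) 𝒰 target x ≤ ENNReal.ofReal (t + t) := fun x hx t ht hux => by
    rcases le_total (gradForm u σ x (a + b)) 0 with hs | hs
    · obtain ⟨v, hv, y, hy, hyη, hyu⟩ := h₁ x
        (Metric.ball_subset_ball (min_le_left _ _) hx) t ⟨ht.1, ht.2.trans (min_le_left _ _)⟩
      refine minTime_le hv (add_nonneg ht.1 ht.1) hy ((hηt hyη).2 ?_)
      have := mul_nonpos_of_nonneg_of_nonpos ht.1 hs
      linarith [hρdef ▸ hyu]
    · obtain ⟨v, hv, y, hy, hyη, hyu⟩ := h₂ x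
        (Metric.ball_subset_ball (min_le_right _ _) hx) t ⟨ht.1, ht.2.trans (min_le_right _ _)⟩
      refine minTime_le hv (add_nonneg ht.1 ht.1) hy ((hηt hyη).2 ?_)
      rw [hq', ← neg_add, map_neg] at hyu
      have := mul_nonneg ht.1 hs
      linarith [hρdef ▸ hyu]
  -- Chosen so that t = A√d gives a decrease ρ/4 · t² = L d, which is at least u(x) - u(c).
  set A := 2 * √(L / ρ) with hA
  have hA0 : 0 < A := by positivity
  have hA2 : ρ / 4 * A ^ 2 = L := by
    rw [hA, mul_pow, Real.sq_sqrt (by positivity)]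
    field_simp
    norm_num
  refine ⟨2 * A, min (min r₀ (δ / 2)) ((δ / A) ^ 2), by positivity, by positivity, fun x hx => ?_⟩
  have hxr : dist x c ≤ min (min r₀ (δ / 2)) ((δ / A) ^ 2) := hx
  obtain ⟨⟨hx₁, hx₂⟩, hx₃⟩ := by simpa only [le_min_iff] using hxr
  have hinf := (Metric.infDist_le_dist_of_mem (x := x) hc).trans hx₃
  have hd0 : 0 ≤ Metric.infDist x target := Metric.infDist_nonneg
  have ht : A * √(Metric.infDist x target) ∈ Icc 0 δ := by
    refine ⟨by positivity, ?_⟩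
    rw [mul_comm, ← le_div_iff₀ hA0]
    exact Real.sqrt_le_iff.2 ⟨by positivity, hinf⟩
  have h := hreach x (Metric.mem_ball.2 (by linarith)) _ ht (by
    rw [mul_pow, Real.sq_sqrt hd0, ← mul_assoc, hA2]
    exact hLd x hx₁)
  rw [← Real.sqrt_eq_rpow]
  convert h using 2
  ring

/-- At the pair (a, -a + s b) the terms in S a·a cancel. What is left is a nonnegative quadratic in
s without constant term, so its linear coefficient, the antisymmetric part of S, vanishes. -/
lemma formS_symm_of_quadK_nonneg {x : E n} (h : ∀ a b : E m, 0 ≤ quadK u σ x a b) (a b : E m) :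
    formS u σ x a b = formS u σ x b a := by
  have h1 : ∀ s : ℝ, 0 ≤ formS u σ x b b * (s * s)
      + (formS u σ x b a - formS u σ x a b) * s + 0 := fun s => by
    have := h a (-a + s • b)
    simp only [quadK, map_add, map_neg, map_smul, add_apply, neg_apply, smul_apply,
      smul_eq_mul] at this
    linarith
  have h2 := discrim_le_zero h1
  rw [discrim, mul_zero, sub_zero] at h2
  have h3 := pow_eq_zero_iff two_ne_zero |>.1 (le_antisymm h2 (sq_nonneg _))
  linarith

lemma formS_self_nonneg_of_quadK_nonneg {x : E n} (h : ∀ a b : E m, 0 ≤ quadK u σ x a b)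
    (a : E m) : 0 ≤ formS u σ x a a := by
  simpa [quadK] using h a 0

/-- If the quadratic form of `K` is nonnegative at `c`, then along every trajectory that starts
close to `c` the function `u` decreases by little. -/
lemma exists_ball_le_of_quadK_nonneg (hσ : ∀ i j, ContDiff ℝ 2 (fun x => σ x i j))
    (hu : ContDiff ℝ 3 u) (h : ∀ a b : E m, 0 ≤ quadK u σ c a b) {ε η : ℝ} (hε : 0 < ε)
    (hη : 0 < η) :
    ∃ R > 0, ∃ M ≥ 0, ∀ x₀ : E n, ∀ a : ℝ → E m, InUnitBall a →
      AEStronglyMeasurable a (volume.restrict (Ici (0 : ℝ))) → ∀ t : ℝ, 0 ≤ t →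
      ∀ x : ℝ → E n, IsTrajectory (symField σ) a x₀ t x → dist x₀ c + M * t < R →
      x t ∈ Metric.ball c η ∧ u x₀ - ‖gradForm u σ x₀‖ * t - ε * t ^ 2 ≤ u (x t) := by
  obtain ⟨R, hR, hS⟩ := exists_ball_formS_bound hσ hu c hε
  obtain ⟨M, hM0, hM⟩ := exists_symField_bound hσ c (min R η)
  refine ⟨min R η, lt_min hR hη, M, hM0, fun x₀ a ha hm t ht x hx hdist => ?_⟩
  have hstay := hx.mem_ball (continuous_symField hσ) ha hm hM0 hM hdist
  have hS' : ∀ s ∈ Icc 0 t, ‖formS u σ (x s) - formS u σ c‖ ≤ ε := fun s hs =>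
    hS _ (Metric.ball_subset_ball (min_le_left _ _) (hstay s hs))
  refine ⟨Metric.ball_subset_ball (min_le_right _ _) (hstay t ⟨ht, le_rfl⟩), ?_⟩
  have hexp := hx.abs_sub_le hσ hu ha hm ht hS' fun s _ => formS_symm_of_quadK_nonneg h _ _
  have hpos := formS_self_nonneg_of_quadK_nonneg h (∫ r in (0 : ℝ)..t, a r)
  have hw : ‖∫ r in (0 : ℝ)..t, a r‖ ≤ t := by
    have := intervalIntegral.norm_integral_le_of_norm_le_const (f := a) (a := 0) (b := t) (C := 1)
      fun r hr => by
        rw [uIoc_of_le ht] at hr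
        simpa using ha r hr.1.le
    simpa [abs_of_nonneg ht] using this
  have hlin := ((gradForm u σ x₀).le_opNorm (∫ r in (0 : ℝ)..t, a r)).trans
    (mul_le_mul_of_nonneg_left hw (norm_nonneg _))
  rw [Real.norm_eq_abs] at hlin
  have h₁ := (abs_le.1 hlin).1
  have h₂ := (abs_le.1 hexp).1
  linarith

/-- If the quadratic form of `K` is nonnegative, then the minimum time is not bounded by the square
root of the distance from `c`. -/
theorem exists_quadK_neg_of_minTime_le (hσ : ∀ i j, ContDiff ℝ 2 (fun x => σ x i j))
    (hu : ContDiff ℝ 3 u) (hgrad : fderiv ℝ u c ≠ 0) (htangent : gradMul u σ c = 0)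
    (htarget : ∀ᶠ x in 𝓝 c, x ∈ target ↔ u x ≤ u c) (h𝒰 : IsControlClass 𝒰)
    {C r : ℝ} (hC : 0 < C) (hr : 0 < r)
    (hT : ∀ x ∈ Metric.closedBall c r, minTime (symField σ) 𝒰 target x
      ≤ ENNReal.ofReal (C * ‖x - c‖ ^ (1 / 2 : ℝ))) :
    ∃ a b : E m, quadK u σ c a b < 0 := by
  by_contra! hnn
  obtain ⟨v, hv⟩ : ∃ v, fderiv ℝ u c v = 1 := by
    obtain ⟨w, hw⟩ := DFunLike.ne_iff.1 hgrad
    exact ⟨(fderiv ℝ u c w)⁻¹ • w, by simpa using inv_mul_cancel₀ hw⟩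
  -- Strictly above C√‖v‖, so the bound on T at c + s²v gives a trajectory that hits the target
  -- before time D s.
  set D := C * √‖v‖ + 1 with hD
  have hD0 : 0 < D := by positivity
  obtain ⟨η, hη, hηt⟩ := Metric.mem_nhds_iff.1 htarget
  -- For t ≤ D s this ε makes the error ε t² at most s²/8.
  obtain ⟨R, hR, M, hM0, hmain⟩ := exists_ball_le_of_quadK_nonneg hσ hu hnn
    (ε := 1 / (8 * D ^ 2)) (by positivity) hη
  have hpath : Tendsto (fun s : ℝ => c + s ^ 2 • v) (𝓝[>] 0) (𝓝 c) := by
    have : Continuous fun s : ℝ => c + s ^ 2 • v := by fun_prop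
    simpa using (this.tendsto 0).mono_left nhdsWithin_le_nhds
  obtain ⟨K, V, hV, hK⟩ := (((contDiff_gradForm hσ hu).of_le one_le_two).contDiffAt
    (x := c)).exists_lipschitzOnWith
  have hg0 : gradForm u σ c = 0 := by simp [gradForm, htangent]
  have hslope : ∀ᶠ s in 𝓝[>] (0 : ℝ), s ^ 2 / 2 ≤ u (c + s ^ 2 • v) - u c := by
    have hd : HasDerivAt (fun h : ℝ => u (c + h • v)) 1 0 := by
      have h1 : HasDerivAt (fun h : ℝ => c + h • v) v 0 := by
        simpa using ((hasDerivAt_id (0 : ℝ)).smul_const v).const_add c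
      have h2 : HasFDerivAt u (fderiv ℝ u c) (c + (0 : ℝ) • v) := by
        simpa using (hu.differentiable (by norm_num) c).hasFDerivAt
      have h3 := h2.comp_hasDerivAt (0 : ℝ) h1
      rwa [hv] at h3
    have hlim := hasDerivAt_iff_tendsto_slope_zero.1 hd
    have hev := hlim.eventually (lt_mem_nhds (by norm_num : (1 / 2 : ℝ) < 1))
    have hsq : Tendsto (fun s : ℝ => s ^ 2) (𝓝[>] 0) (𝓝[≠] 0) := by
      refine tendsto_nhdsWithin_iff.2 ⟨?_, ?_⟩
      · simpa using ((continuous_pow 2).tendsto (0 : ℝ)).mono_left nhdsWithin_le_nhds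
      · filter_upwards [self_mem_nhdsWithin] with s hs using pow_ne_zero 2 (ne_of_gt hs)
    filter_upwards [hsq.eventually hev, self_mem_nhdsWithin] with s hs hs0
    have hs2 : 0 < s ^ 2 := pow_pos hs0 2
    simp only [zero_add, zero_smul, add_zero, smul_eq_mul] at hs
    rw [inv_mul_eq_div, lt_div_iff₀ hs2] at hs
    linarith
  have hdist : ∀ᶠ s in 𝓝[>] (0 : ℝ), dist (c + s ^ 2 • v) c + M * (D * s) < R := by
    have : Continuous fun s : ℝ => dist (c + s ^ 2 • v) c + M * (D * s) := by fun_prop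
    exact (this.tendsto 0).mono_left nhdsWithin_le_nhds |>.eventually
      (gt_mem_nhds (by simpa using hR))
  -- Since ∇uσ vanishes at c, it is at most K‖v‖s² at the starting point; over time D s its
  -- contribution is of order s³, here below s²/8. The two losses total s²/4, less than the initial
  -- excess s²/2.
  have hsmall : ∀ᶠ s in 𝓝[>] (0 : ℝ), K * ‖v‖ * D * s < 1 / 8 := by
    have : Continuous fun s : ℝ => K * ‖v‖ * D * s := by fun_prop
    exact (this.tendsto 0).mono_left nhdsWithin_le_nhds |>.eventually
      (gt_mem_nhds (by norm_num))
  obtain ⟨s, hs0, hs₁, hs₂, hs₃, hs₄, hs₅⟩ := (eventually_mem_nhdsWithin.and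
    (hslope.and (hdist.and (hsmall.and ((hpath.eventually hV).and
      (hpath.eventually (Metric.closedBall_mem_nhds c hr))))))).exists
  replace hs0 : 0 < s := hs0
  have hbound := hT _ hs₅
  have hlt : minTime (symField σ) 𝒰 target (c + s ^ 2 • v) < ENNReal.ofReal (D * s) := by
    refine hbound.trans_lt ((ENNReal.ofReal_lt_ofReal_iff (by positivity)).2 ?_)
    rw [← Real.sqrt_eq_rpow, add_sub_cancel_left, norm_smul, norm_pow, Real.norm_of_nonneg hs0.le,
      Real.sqrt_mul (by positivity), Real.sqrt_sq hs0.le, hD]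
    linarith
  simp only [minTime, hittingTime, iInf_lt_iff, sInf_lt_iff] at hlt
  obtain ⟨a, ha, θ, ⟨t, ht, rfl, x, hx, hxt⟩, hθ⟩ := hlt
  have htD : t < D * s := (ENNReal.ofReal_lt_ofReal_iff (by positivity)).1 hθ
  have hMt : M * t ≤ M * (D * s) := mul_le_mul_of_nonneg_left htD.le hM0
  obtain ⟨hball, hle⟩ := hmain _ a (h𝒰.inUnitBall a ha) (h𝒰.measurable a ha) t ht x hx (by linarith)
  have hux : u (x t) ≤ u c := (hηt hball).1 hxt
  have hg : ‖gradForm u σ (c + s ^ 2 • v)‖ ≤ K * ‖v‖ * s ^ 2 := by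
    have := hK.dist_le_mul _ hs₄ c (mem_of_mem_nhds hV)
    rw [hg0, dist_zero_right, dist_eq_norm, add_sub_cancel_left, norm_smul, norm_pow,
      Real.norm_of_nonneg hs0.le] at this
    linarith
  have e₁ : ‖gradForm u σ (c + s ^ 2 • v)‖ * t ≤ s ^ 2 * (1 / 8) := calc
    _ ≤ K * ‖v‖ * s ^ 2 * (D * s) := by gcongr
    _ = s ^ 2 * (K * ‖v‖ * D * s) := by ring
    _ ≤ _ := by gcongr
  have e₂ : 1 / (8 * D ^ 2) * t ^ 2 ≤ s ^ 2 * (1 / 8) := calc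
    _ ≤ 1 / (8 * D ^ 2) * (D * s) ^ 2 := by gcongr
    _ = _ := by field_simp
  have := pow_pos hs0 2
  linarith

end MinTime

end SymControl

end

theorem mainTheorem2 {n m : ℕ}
    (σ : SymControl.E n → Matrix (Fin n) (Fin m) ℝ)
    (hσ : ∀ i j, ContDiff ℝ 2 (fun x => σ x i j))
    (u : SymControl.E n → ℝ) (hu : ContDiff ℝ 3 u)
    (xbar : SymControl.E n)
    (hgrad : fderiv ℝ u xbar ≠ 0)
    (htangent : SymControl.gradMul u σ xbar = 0)
    (target : Set (SymControl.E n))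
    (htarget : ∀ᶠ x in 𝓝 xbar, x ∈ target ↔ u x ≤ u xbar)
    (𝒰 : Set (ℝ → SymControl.E m)) (h𝒰 : SymControl.IsControlClass 𝒰) :
    (SymControl.matK u σ xbar).IsSymm ∧
    ((∃ C r : ℝ, 0 < C ∧ 0 < r ∧ ∀ x ∈ Metric.closedBall xbar r,
        SymControl.minTime (SymControl.symField σ) 𝒰 target x
          ≤ ENNReal.ofReal (C * ‖x - xbar‖ ^ (1 / 2 : ℝ)))
      ↔ SymControl.HasNegEigenvalue (SymControl.matK u σ xbar)) ∧
    (SymControl.HasNegEigenvalue (SymControl.matK u σ xbar)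
      ↔ SymControl.SecondOrderCondition (SymControl.symField σ) u xbar) ∧
    (SymControl.HasNegEigenvalue (SymControl.matK u σ xbar) →
      ∃ C r : ℝ, 0 < C ∧ 0 < r ∧ ∀ x ∈ Metric.closedBall xbar r,
        SymControl.minTime (SymControl.symField σ) 𝒰 target x
          ≤ ENNReal.ofReal (C * Metric.infDist x target ^ (1 / 2 : ℝ))) := by
  rw [SymControl.secondOrderCondition_iff hσ hu, SymControl.hasNegEigenvalue_matK_iff]
  refine ⟨SymControl.matK_isSymm xbar, ⟨?_, fun h => ?_⟩, Iff.rfl,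
    SymControl.exists_minTime_le_sqrt_infDist hσ hu htarget h𝒰⟩
  · rintro ⟨C, r, hC, hr, hT⟩
    exact SymControl.exists_quadK_neg_of_minTime_le hσ hu hgrad htangent htarget h𝒰 hC hr hT
  · obtain ⟨C, r, hC, hr, hT⟩ :=
      SymControl.exists_minTime_le_sqrt_infDist hσ hu htarget h𝒰 h
    refine ⟨C, r, hC, hr, fun x hx => (hT x hx).trans (ENNReal.ofReal_le_ofReal ?_)⟩
    have hmem : xbar ∈ target := htarget.self_of_nhds.2 le_rfl
    have := Metric.infDist_le_dist_of_mem (x := x) hmem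
    rw [dist_eq_norm] at this
    have h0 : 0 ≤ Metric.infDist x target := Metric.infDist_nonneg
    gcongr
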